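/- Let $\mathcal C$ be a bicategory and $W$ a class of $1$-morphisms of $\mathcal C$ such that $(\mathcal C,W)$ admits a right bicalculus of fractions, i.e.: * (BF1) all identities are in $W$; (BF2) $W$ is closed under composition; * (BF3) for $w:A\to B$ in $W$ and $f:C\to B$ there are $w':D\to C$ in $W$, $f':D\to A$ and an invertible $2$-morphism $f\circ w'\Rightarrow w\circ f'$; * (BF4) for $w:B\to A$ in $W$, $f^1,f^2:C\to B$ and $\alpha:w\circ f^1\Rightarrow w\circ f^2$ there are $v:D\to C$ in $W$ and $\beta:f^1\circ v\Rightarrow f^2\circ v$ with $\alpha\circ v=w\circ\beta$, with $\beta$ invertible if $\alpha$ is; and for any two such pairs $(v:D\to C,\beta)$, $(v':D'\to C,\beta')$ there are $p:E\to D$, $p':E\to D'$ with $v\circ p$ in $W$ and an invertible $\zeta:v\circ p\Rightarrow v'\circ p'$ such that the composite of $f^1\circ\zeta$ with $\beta'\circ p'$ equals the composite of $\beta\circ p$ with $f^2\circ\zeta$; * (BF5) if $w\in W$ and there is an invertible $v\Rightarrow w$, then $v\in W$. (Associators of $\mathcal C$ are left implicit.) Fix a set of choices $C(W)$: for every $f:A'\to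 B$ and every $v:B'\to B$ in $W$, an object $A''$, morphisms $v':A''\to A'$ in $W$ and $f':A''\to B'$, and an invertible $\rho:f\circ v'\Rightarrow v\circ f'$. In the bicategory of fractions $\mathcal C[W^{-1}]$, a morphism $A\to B$ is a triple $(A',w,f)$ with $w:A'\to A$ in $W$ and $f:A'\to B$; the composite of $(A',w,f):A\to B$ and $(B',v,g):B\to C$ is $(A'',w\circ v',g\circ f')$, with $(A'',v',f',\rho)$ chosen by $C(W)$ for $(f,v)$. A $2$-morphism $(A^1,w^1,f^1)\Rightarrow(A^2,w^2,f^2)$ is a class of data $(A^3,v^1,v^2,\alpha,\beta)$, where $v^m:A^3\to A^m$, $w^1\circ v^1\in W$, $\alpha:w^1\circ v^1\Rightarrow w^2\circ v^2$ is invertible and $\beta:f^1\circ v^1\Rightarrow f^2\circ v^2$. Data $(A^3,v^1,v^2,\alpha,\beta)$ and $(A'^3,v'^1,v'^2,\alpha',\beta')$ are equivalent if there are $z:A^4\to A^3$, $z':A^4\to A'^3$ with $w^1\circ v^1\circ z\in W$ and invertible $\sigma^1:v'^1\circ z'\Rightarrow v^1\circ z$, $\sigma^2:v^2\circ z\Rightarrow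 v'^2\circ z'$ such that $\alpha'\circ z'$ is the vertical composite of $w^1\circ\sigma^1$, $\alpha\circ z$, $w^2\circ\sigma^2$, and $\beta'\circ z'$ that of $f^1\circ\sigma^1$, $\beta\circ z$, $f^2\circ\sigma^2$. Let $\underline g=(B',u,g):B\to C$ and $\underline f^m=(A^m,w^m,f^m):A\to B$ $(m=1,2)$ be morphisms and $\Gamma:\underline f^1\Rightarrow\underline f^2$ a $2$-morphism of $\mathcal C[W^{-1}]$. Let $C(W)$ give $u^m:D^m\to A^m$ in $W$, $h^m:D^m\to B'$ and invertible $\rho^m:f^m\circ u^m\Rightarrow u\circ h^m$, so that $\underline g\circ\underline f^m=(D^m,w^m\circ u^m,g\circ h^m)$. For a representative $(A^3,v^1,v^2,\alpha,\beta)$ of $\Gamma$ consider any data as follows: * (F8) $u^3:D^3\to A^3$ and $u^5:D^4\to A^3$ in $W$, $u^4:D^3\to D^1$, $u^6:D^4\to D^2$, and invertible $\eta^1:v^1\circ u^3\Rightarrow u^1\circ u^4$, $\eta^2:v^2\circ u^5\Rightarrow u^2\circ u^6$; * (F9) $u^7:D^5\to D^3$ in $W$, $u^8:D^5\to D^4$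 and an invertible $\eta^3:u^3\circ u^7\Rightarrow u^5\circ u^8$; * (F10) a $2$-morphism $\lambda:h^1\circ u^4\circ u^7\Rightarrow h^2\circ u^6\circ u^8$ such that $u\circ\lambda$ is the composite $$u h^1u^4u^7\Rightarrow f^1u^1u^4u^7\Rightarrow f^1v^1u^3u^7\Rightarrow f^1v^1u^5u^8\Rightarrow f^2v^2u^5u^8\Rightarrow f^2u^2u^6u^8\Rightarrow u h^2u^6u^8$$ of the whiskerings of $(\rho^1)^{-1},(\eta^1)^{-1},\eta^3,\beta,\eta^2,\rho^2$. Let $\mu:w^1u^1u^4u^7\Rightarrow w^1v^1u^3u^7\Rightarrow w^1v^1u^5u^8\Rightarrow w^2v^2u^5u^8\Rightarrow w^2u^2u^6u^8$ be the composite of the whiskerings of $(\eta^1)^{-1},\eta^3,\alpha,\eta^2$. A set of choices $D(W)$ selects, for every $w:B\to A$ in $W$, $f^1,f^2:C\to B$ and $\alpha:w\circ f^1\Rightarrow w\circ f^2$, a morphism $v:D\to C$ in $W$ and $\beta:f^1\circ v\Rightarrow f^2\circ v$ with $\alpha\circ v=w\circ\beta$. Given $C(W)$ and $D(W)$, Pronk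 defines $\underline g\circ\Gamma$ as the class of $(D^5,u^4\circ u^7,u^6\circ u^8,\mu,g\circ\lambda)$, for one representative of $\Gamma$ and the following data (F8)–(F10): $C(W)$ gives (F8), and gives $p^7:R\to D^3$ in $W$, $p^8:R\to D^4$, $\tilde\eta^3:u^3\circ p^7\Rightarrow u^5\circ p^8$; $D(W)$, applied to $u$ and the composite in (F10) formed with $(p^7,p^8,\tilde\eta^3)$, gives $q:D^5\to R$ in $W$ and $\lambda$; and $u^7=p^7\circ q$, $u^8=p^8\circ q$, $\eta^3=\tilde\eta^3\circ q$. Then: 1. for every set of choices $D(W)$, every representative of $\Gamma$ and all data (F8)–(F10) for it, $\underline g\circ\Gamma$ is represented by $(D^5,\,u^4\circ u^7,\,u^6\circ u^8,\,\mu,\,g\circ\lambda)$; 2. any two representatives of $\Gamma$, with any data (F8)–(F10) for each, yield equivalent data $(D^5,u^4\circ u^7,u^6\circ u^8,\mu,g\circ\lambda)$; 3. hence $\underline g\circ\Gamma$ does not depend on the set of choices $D(W)$. -/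

import Mathlib

open CategoryTheory Bicategory

universe w v u

noncomputable section

namespace BicategoryOfFractions

variable {C : Type u} [Bicategory.{w, v} C]

/-! Compositions of 1-morphisms are written in diagrammatic order: `f ≫ g` is `g ∘ f`.
For a 2-morphism `γ`, the whiskering `g ∘ γ` is `γ ▷ g` and `γ ∘ v` is `v ◁ γ`. -/

/-- `(D, v, β)` solves `α : w ∘ f¹ ⇒ w ∘ f²`, that is `α ∘ v = w ∘ β`. -/
def IsLift {A B X D : C} {w : B ⟶ A} {f₁ f₂ : X ⟶ B} (α : f₁ ≫ w ⟶ f₂ ≫ w)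
    (v : D ⟶ X) (β : v ≫ f₁ ⟶ v ≫ f₂) : Prop :=
  v ◁ α = (α_ v f₁ w).inv ≫ β ▷ w ≫ (α_ v f₂ w).hom

/-- The pair `(C, W)` admits a right bicalculus of fractions. -/
structure AdmitsBicalculus (W : MorphismProperty C) : Prop where
  /-- identities belong to `W` -/
  id_mem : ∀ A : C, W (𝟙 A)
  /-- `W` is closed under composition -/
  comp_mem : ∀ {X Y Z : C} (f : X ⟶ Y) (g : Y ⟶ Z), W f → W g → W (f ≫ g)
  /-- squares can be completed, up to an invertible 2-morphism -/
  exists_square : ∀ {A B X : C} (w : A ⟶ B) (f : X ⟶ B), W w →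
    ∃ (D : C) (w' : D ⟶ X) (f' : D ⟶ A), W w' ∧ Nonempty (w' ≫ f ≅ f' ≫ w)
  /-- 2-morphisms can be lifted along `W`, invertible ones to invertible ones -/
  exists_lift : ∀ {A B X : C} (w : B ⟶ A), W w → ∀ (f₁ f₂ : X ⟶ B) (α : f₁ ≫ w ⟶ f₂ ≫ w),
    ∃ (D : C) (v : D ⟶ X) (β : v ≫ f₁ ⟶ v ≫ f₂), W v ∧ IsLift α v β ∧ (IsIso α → IsIso β)
  /-- any two such lifts agree after a further restriction -/
  lift_unique : ∀ {A B X : C} (w : B ⟶ A), W w → ∀ (f₁ f₂ : X ⟶ B) (α : f₁ ≫ w ⟶ f₂ ≫ w)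
    {D D' : C} (v : D ⟶ X) (v' : D' ⟶ X) (β : v ≫ f₁ ⟶ v ≫ f₂) (β' : v' ≫ f₁ ⟶ v' ≫ f₂),
    W v → W v' → IsLift α v β → IsLift α v' β' →
    ∃ (E : C) (p : E ⟶ D) (p' : E ⟶ D') (ζ : p ≫ v ≅ p' ≫ v'), W (p ≫ v) ∧
      ζ.hom ▷ f₁ ≫ (α_ p' v' f₁).hom ≫ p' ◁ β' ≫ (α_ p' v' f₂).inv =
        (α_ p v f₁).hom ≫ p ◁ β ≫ (α_ p v f₂).inv ≫ ζ.hom ▷ f₂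
  /-- `W` is closed under invertible 2-morphisms -/
  iso_mem : ∀ {X Y : C} (v w : X ⟶ Y), W w → Nonempty (v ≅ w) → W v

/-- A completion of `A' --f--> B <--v-- B'` to a square: an object `D`, a morphism
`leg : D ⟶ A'` in `W`, a morphism `top : D ⟶ B'` and an invertible 2-morphism
`ρ : f ∘ leg ⇒ v ∘ top`. -/
structure Square (W : MorphismProperty C) {A' B B' : C} (f : A' ⟶ B) (v : B' ⟶ B) where
  D : C
  leg : D ⟶ A'
  leg_mem : W leg
  top : D ⟶ B'
  ρ : leg ≫ f ≅ top ≫ v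

/-- A lift of `α : w ∘ f¹ ⇒ w ∘ f²`: a morphism `v : D ⟶ X` in `W` and a 2-morphism
`β : f¹ ∘ v ⇒ f² ∘ v` with `α ∘ v = w ∘ β`. -/
structure Lift (W : MorphismProperty C) {A B X : C} {w : B ⟶ A} {f₁ f₂ : X ⟶ B}
    (α : f₁ ≫ w ⟶ f₂ ≫ w) where
  D : C
  v : D ⟶ X
  v_mem : W v
  β : v ≫ f₁ ⟶ v ≫ f₂
  isLift : IsLift α v β

/-- A set of choices `C(W)`. -/
def ChoicesC (W : MorphismProperty C) :=
  ∀ ⦃A' B B' : C⦄ (f : A' ⟶ B) (v : B' ⟶ B), W v → Square W f v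

/-- A set of choices `D(W)`. -/
def ChoicesD (W : MorphismProperty C) :=
  ∀ ⦃A B X : C⦄ (w : B ⟶ A), W w → ∀ (f₁ f₂ : X ⟶ B) (α : f₁ ≫ w ⟶ f₂ ≫ w), Lift W α

/-- Morphisms `A ⟶ B` of the bicategory of fractions: triples `(A', w, f)` with `w : A' ⟶ A`
in `W` and `f : A' ⟶ B`. -/
structure Mor (W : MorphismProperty C) (A B : C) where
  A' : C
  w : A' ⟶ A
  w_mem : W w
  f : A' ⟶ B

/-- Composition `g ∘ f` of morphisms in the bicategory of fractions. -/
def Mor.comp {W : MorphismProperty C} (hW : AdmitsBicalculus W) (c : ChoicesC W) {A B X : C}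
    (f : Mor W A B) (g : Mor W B X) : Mor W A X where
  A' := (c f.f g.w g.w_mem).D
  w := (c f.f g.w g.w_mem).leg ≫ f.w
  w_mem := hW.comp_mem _ _ (c f.f g.w g.w_mem).leg_mem f.w_mem
  f := (c f.f g.w g.w_mem).top ≫ g.f

/-- Data `(A³, v¹, v², α, β)` representing 2-morphisms of the bicategory of fractions. -/
structure TwoMorData {W : MorphismProperty C} {A B : C} (f₁ f₂ : Mor W A B) where
  A₃ : C
  v₁ : A₃ ⟶ f₁.A'
  v₂ : A₃ ⟶ f₂.A'
  mem : W (v₁ ≫ f₁.w)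
  α : v₁ ≫ f₁.w ≅ v₂ ≫ f₂.w
  β : v₁ ≫ f₁.f ⟶ v₂ ≫ f₂.f

/-- Equivalence of data representing 2-morphisms, through some `(A⁴, z, z', σ¹, σ²)`. -/
def TwoMorData.Equivalent {W : MorphismProperty C} {A B : C} {f₁ f₂ : Mor W A B} (r r' : TwoMorData f₁ f₂) :
    Prop :=
  ∃ (A₄ : C) (z : A₄ ⟶ r.A₃) (z' : A₄ ⟶ r'.A₃)
    (σ₁ : z' ≫ r'.v₁ ≅ z ≫ r.v₁) (σ₂ : z ≫ r.v₂ ≅ z' ≫ r'.v₂),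
    W ((z ≫ r.v₁) ≫ f₁.w) ∧
    σ₁.hom ▷ f₁.w ≫ (α_ z r.v₁ f₁.w).hom ≫ z ◁ r.α.hom ≫ (α_ z r.v₂ f₂.w).inv ≫ σ₂.hom ▷ f₂.w =
      (α_ z' r'.v₁ f₁.w).hom ≫ z' ◁ r'.α.hom ≫ (α_ z' r'.v₂ f₂.w).inv ∧
    σ₁.hom ▷ f₁.f ≫ (α_ z r.v₁ f₁.f).hom ≫ z ◁ r.β ≫ (α_ z r.v₂ f₂.f).inv ≫ σ₂.hom ▷ f₂.f =
      (α_ z' r'.v₁ f₁.f).hom ≫ z' ◁ r'.β ≫ (α_ z' r'.v₂ f₂.f).inv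

theorem TwoMorData.Equivalent.refl {W : MorphismProperty C} (hW : AdmitsBicalculus W) {A B : C}
    {f₁ f₂ : Mor W A B} (r : TwoMorData f₁ f₂) : r.Equivalent r := by
  refine ⟨r.A₃, 𝟙 _, 𝟙 _, Iso.refl _, Iso.refl _, ?_, ?_, ?_⟩
  · exact hW.iso_mem _ _ r.mem ⟨whiskerRightIso (λ_ _) _⟩
  · simp
  · simp

theorem TwoMorData.Equivalent.symm {W : MorphismProperty C} (hW : AdmitsBicalculus W) {A B : C}
    {f₁ f₂ : Mor W A B} {r r' : TwoMorData f₁ f₂} (h : r.Equivalent r') : r'.Equivalent r := by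
  obtain ⟨A₄, z, z', σ₁, σ₂, hz, h1, h2⟩ := h
  refine ⟨A₄, z', z, σ₁.symm, σ₂.symm, ?_, ?_, ?_⟩
  · exact hW.iso_mem _ _ hz ⟨whiskerRightIso σ₁ _⟩
  · rw [← cancel_epi (σ₁.hom ▷ f₁.w), ← cancel_mono (σ₂.hom ▷ f₂.w)]
    simp only [Category.assoc] at h1 ⊢
    simp [← comp_whiskerRight_assoc, ← comp_whiskerRight, h1]
  · rw [← cancel_epi (σ₁.hom ▷ f₁.f), ← cancel_mono (σ₂.hom ▷ f₂.f)]
    simp only [Category.assoc] at h2 ⊢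
    simp [← comp_whiskerRight_assoc, ← comp_whiskerRight, h2]

/-- Pasting two compatible comparisons along an invertible 2-morphism `θ`. -/
theorem paste_aux {A₃ A₃' A₃'' A₄ A₅ E X₁ X₂ Y : C}
    {v₁ : A₃ ⟶ X₁} {v₂ : A₃ ⟶ X₂} {v₁' : A₃' ⟶ X₁} {v₂' : A₃' ⟶ X₂}
    {v₁'' : A₃'' ⟶ X₁} {v₂'' : A₃'' ⟶ X₂} {k₁ : X₁ ⟶ Y} {k₂ : X₂ ⟶ Y}
    (γ : v₁ ≫ k₁ ⟶ v₂ ≫ k₂) (γ' : v₁' ≫ k₁ ⟶ v₂' ≫ k₂) (γ'' : v₁'' ≫ k₁ ⟶ v₂'' ≫ k₂)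
    {z : A₄ ⟶ A₃} {z' : A₄ ⟶ A₃'} {y : A₅ ⟶ A₃'} {y' : A₅ ⟶ A₃''} {p : E ⟶ A₄} {q : E ⟶ A₅}
    (θ : q ≫ y ≅ p ≫ z')
    (σ₁ : z' ≫ v₁' ≅ z ≫ v₁) (σ₂ : z ≫ v₂ ≅ z' ≫ v₂')
    (τ₁ : y' ≫ v₁'' ≅ y ≫ v₁') (τ₂ : y ≫ v₂' ≅ y' ≫ v₂'')
    (h : σ₁.hom ▷ k₁ ≫ (α_ z v₁ k₁).hom ≫ z ◁ γ ≫ (α_ z v₂ k₂).inv ≫ σ₂.hom ▷ k₂ =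
      (α_ z' v₁' k₁).hom ≫ z' ◁ γ' ≫ (α_ z' v₂' k₂).inv)
    (h' : τ₁.hom ▷ k₁ ≫ (α_ y v₁' k₁).hom ≫ y ◁ γ' ≫ (α_ y v₂' k₂).inv ≫ τ₂.hom ▷ k₂ =
      (α_ y' v₁'' k₁).hom ≫ y' ◁ γ'' ≫ (α_ y' v₂'' k₂).inv) :
    (α_ q y' v₁'' ≪≫ whiskerLeftIso q τ₁ ≪≫ (α_ q y v₁').symm ≪≫ whiskerRightIso θ v₁' ≪≫
        α_ p z' v₁' ≪≫ whiskerLeftIso p σ₁ ≪≫ (α_ p z v₁).symm).hom ▷ k₁ ≫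
      (α_ (p ≫ z) v₁ k₁).hom ≫ (p ≫ z) ◁ γ ≫ (α_ (p ≫ z) v₂ k₂).inv ≫
      (α_ p z v₂ ≪≫ whiskerLeftIso p σ₂ ≪≫ (α_ p z' v₂').symm ≪≫ whiskerRightIso θ.symm v₂' ≪≫
        α_ q y v₂' ≪≫ whiskerLeftIso q τ₂ ≪≫ (α_ q y' v₂'').symm).hom ▷ k₂ =
      (α_ (q ≫ y') v₁'' k₁).hom ≫ (q ≫ y') ◁ γ'' ≫ (α_ (q ≫ y') v₂'' k₂).inv := by
  have e : θ.hom ▷ (v₁' ≫ k₁) ≫ (p ≫ z') ◁ γ' ≫ θ.inv ▷ (v₂' ≫ k₂) = (q ≫ y) ◁ γ' := by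
    rw [← whisker_exchange_assoc]
    simp
  calc
    _ = 𝟙 _ ⊗≫ q ◁ τ₁.hom ▷ k₁ ⊗≫ θ.hom ▷ (v₁' ≫ k₁) ⊗≫
        p ◁ (σ₁.hom ▷ k₁ ≫ (α_ z v₁ k₁).hom ≫ z ◁ γ ≫ (α_ z v₂ k₂).inv ≫ σ₂.hom ▷ k₂) ⊗≫
        θ.inv ▷ (v₂' ≫ k₂) ⊗≫ q ◁ τ₂.hom ▷ k₂ ⊗≫ 𝟙 _ := by
      simp only [Iso.trans_hom, whiskerLeftIso_hom, whiskerRightIso_hom, Iso.symm_hom]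
      bicategory
    _ = 𝟙 _ ⊗≫ q ◁ τ₁.hom ▷ k₁ ⊗≫
        (θ.hom ▷ (v₁' ≫ k₁) ≫ (p ≫ z') ◁ γ' ≫ θ.inv ▷ (v₂' ≫ k₂)) ⊗≫
        q ◁ τ₂.hom ▷ k₂ ⊗≫ 𝟙 _ := by
      rw [h]
      bicategory
    _ = 𝟙 _ ⊗≫ q ◁ (τ₁.hom ▷ k₁ ≫ (α_ y v₁' k₁).hom ≫ y ◁ γ' ≫ (α_ y v₂' k₂).inv ≫
        τ₂.hom ▷ k₂) ⊗≫ 𝟙 _ := by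
      rw [e]
      bicategory
    _ = _ := by
      rw [h']
      bicategory

theorem TwoMorData.Equivalent.trans {W : MorphismProperty C} (hW : AdmitsBicalculus W) {A B : C}
    {f₁ f₂ : Mor W A B} {r r' r'' : TwoMorData f₁ f₂} (h : r.Equivalent r') (h' : r'.Equivalent r'') :
    r.Equivalent r'' := by
  obtain ⟨A₄, z, z', σ₁, σ₂, hz, h1, h2⟩ := h
  obtain ⟨A₅, y, y', τ₁, τ₂, hy, k1, k2⟩ := h'
  have hz' : W (z' ≫ r'.v₁ ≫ f₁.w) :=
    hW.iso_mem _ _ hz ⟨(α_ _ _ _).symm ≪≫ whiskerRightIso σ₁ _⟩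
  obtain ⟨P, s, t, hs, ⟨κ⟩⟩ := hW.exists_square (z' ≫ r'.v₁ ≫ f₁.w) (y ≫ r'.v₁ ≫ f₁.w) hz'
  obtain ⟨E, m, β, hm, -, hβ⟩ := hW.exists_lift (r'.v₁ ≫ f₁.w) r'.mem (s ≫ y) (t ≫ z')
    ((α_ _ _ _ ≪≫ κ ≪≫ (α_ _ _ _).symm).hom)
  have hβ' : IsIso β := hβ inferInstance
  let θ : (m ≫ s) ≫ y ≅ (m ≫ t) ≫ z' := α_ _ _ _ ≪≫ asIso β ≪≫ (α_ _ _ _).symm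
  refine ⟨E, (m ≫ t) ≫ z, (m ≫ s) ≫ y', _, _, ?_,
    paste_aux _ _ _ θ σ₁ σ₂ τ₁ τ₂ h1 k1, paste_aux _ _ _ θ σ₁ σ₂ τ₁ τ₂ h2 k2⟩
  have hE : W ((m ≫ s) ≫ y ≫ r'.v₁ ≫ f₁.w) :=
    hW.comp_mem _ _ (hW.comp_mem _ _ hm hs)
      (hW.iso_mem _ _ hy ⟨(α_ _ _ _).symm⟩)
  refine hW.iso_mem _ _ hE ⟨?_⟩
  exact α_ _ _ _ ≪≫ α_ _ _ _ ≪≫ whiskerLeftIso (m ≫ t) ((α_ _ _ _).symm ≪≫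
    whiskerRightIso σ₁.symm f₁.w ≪≫ α_ _ _ _) ≪≫ (α_ _ _ _).symm ≪≫
    whiskerRightIso θ.symm _ ≪≫ α_ _ _ _

/-- Equivalence of data is an equivalence relation. -/
def repSetoid {W : MorphismProperty C} (hW : AdmitsBicalculus W) {A B : C}
    (f₁ f₂ : Mor W A B) : Setoid (TwoMorData f₁ f₂) where
  r := TwoMorData.Equivalent
  iseqv := ⟨.refl hW, .symm hW, .trans hW⟩

/-- 2-morphisms `f₁ ⇒ f₂` of the bicategory of fractions. -/
def TwoMor {W : MorphismProperty C} (hW : AdmitsBicalculus W) {A B : C}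
    (f₁ f₂ : Mor W A B) := Quotient (repSetoid hW f₁ f₂)

/-- The 2-morphism represented by given data. -/
def TwoMorData.toTwoMor {W : MorphismProperty C} (hW : AdmitsBicalculus W) {A B : C}
    {f₁ f₂ : Mor W A B} (r : TwoMorData f₁ f₂) : TwoMor hW f₁ f₂ := Quotient.mk (repSetoid hW f₁ f₂) r

section Whisker

variable {W : MorphismProperty C} (c : ChoicesC W) {A B X : C} {f₁ f₂ : Mor W A B}

/-- The composition
`u h¹ u⁴ u⁷ ⇒ f¹ u¹ u⁴ u⁷ ⇒ f¹ v¹ u³ u⁷ ⇒ f¹ v¹ u⁵ u⁸ ⇒ f² v² u⁵ u⁸ ⇒ f² u² u⁶ u⁸ ⇒ u h² u⁶ u⁸`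
of `(ρ¹)⁻¹`, `(η¹)⁻¹`, `η³`, `β`, `η²` and `ρ²`, where
`(D¹, u¹, h¹, ρ¹)`, `(D², u², h², ρ²)` are the squares chosen for `(f¹, u)`, `(f², u)`,
and `e₁ = (D³, u³, u⁴, η¹)`, `e₂ = (D⁴, u⁵, u⁶, η²)`, `e₃ = (D⁵, u⁷, u⁸, η³)`. -/
def pasting (r : TwoMorData f₁ f₂) (g : Mor W B X)
    (e₁ : Square W r.v₁ (c f₁.f g.w g.w_mem).leg) (e₂ : Square W r.v₂ (c f₂.f g.w g.w_mem).leg)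
    (e₃ : Square W e₁.leg e₂.leg) :
    (e₃.leg ≫ e₁.top ≫ (c f₁.f g.w g.w_mem).top) ≫ g.w ⟶
      (e₃.top ≫ e₂.top ≫ (c f₂.f g.w g.w_mem).top) ≫ g.w :=
  𝟙 _ ⊗≫ (e₃.leg ≫ e₁.top) ◁ (c f₁.f g.w g.w_mem).ρ.inv ⊗≫
    e₃.leg ◁ e₁.ρ.inv ▷ f₁.f ⊗≫
    e₃.ρ.hom ▷ (r.v₁ ≫ f₁.f) ⊗≫
    (e₃.top ≫ e₂.leg) ◁ r.β ⊗≫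
    e₃.top ◁ e₂.ρ.hom ▷ f₂.f ⊗≫
    (e₃.top ≫ e₂.top) ◁ (c f₂.f g.w g.w_mem).ρ.hom ⊗≫ 𝟙 _

/-- The invertible 2-morphism `μ`, the composition
`w¹ u¹ u⁴ u⁷ ⇒ w¹ v¹ u³ u⁷ ⇒ w¹ v¹ u⁵ u⁸ ⇒ w² v² u⁵ u⁸ ⇒ w² u² u⁶ u⁸`
of `(η¹)⁻¹`, `η³`, `α` and `η²`. -/
def mu (r : TwoMorData f₁ f₂) (g : Mor W B X)
    (e₁ : Square W r.v₁ (c f₁.f g.w g.w_mem).leg) (e₂ : Square W r.v₂ (c f₂.f g.w g.w_mem).leg)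
    (e₃ : Square W e₁.leg e₂.leg) :
    (e₃.leg ≫ e₁.top) ≫ (c f₁.f g.w g.w_mem).leg ≫ f₁.w ≅
      (e₃.top ≫ e₂.top) ≫ (c f₂.f g.w g.w_mem).leg ≫ f₂.w :=
  Iso.refl _ ≪⊗≫ whiskerLeftIso e₃.leg (whiskerRightIso e₁.ρ.symm f₁.w) ≪⊗≫
    whiskerRightIso e₃.ρ (r.v₁ ≫ f₁.w) ≪⊗≫
    whiskerLeftIso (e₃.top ≫ e₂.leg) r.α ≪⊗≫
    whiskerLeftIso e₃.top (whiskerRightIso e₂.ρ f₂.w) ≪⊗≫ Iso.refl _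

/-- Data from which a representative of `g ∘ Γ` is built, given a representative `r` of `Γ`:
squares `η₁ = (D³, u³, u⁴, η¹)`, `η₂ = (D⁴, u⁵, u⁶, η²)`, `η₃ = (D⁵, u⁷, u⁸, η³)`, and a
2-morphism `lam` with `u ∘ lam` equal to the pasting of the diagram. -/
structure WhiskerData (r : TwoMorData f₁ f₂) (g : Mor W B X) where
  η₁ : Square W r.v₁ (c f₁.f g.w g.w_mem).leg
  η₂ : Square W r.v₂ (c f₂.f g.w g.w_mem).leg
  η₃ : Square W η₁.leg η₂.leg
  lam : η₃.leg ≫ η₁.top ≫ (c f₁.f g.w g.w_mem).top ⟶ η₃.top ≫ η₂.top ≫ (c f₂.f g.w g.w_mem).top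
  lam_eq : lam ▷ g.w = pasting c r g η₁ η₂ η₃

variable {c} in
/-- The 2-morphism `g ∘ lam`, from `(g ∘ h¹) ∘ (u⁴ ∘ u⁷)` to `(g ∘ h²) ∘ (u⁶ ∘ u⁸)`. -/
def WhiskerData.gLam {r : TwoMorData f₁ f₂} {g : Mor W B X} (F : WhiskerData c r g) :
    (F.η₃.leg ≫ F.η₁.top) ≫ (c f₁.f g.w g.w_mem).top ≫ g.f ⟶
      (F.η₃.top ≫ F.η₂.top) ≫ (c f₂.f g.w g.w_mem).top ≫ g.f :=
  𝟙 _ ⊗≫ F.lam ▷ g.f ⊗≫ 𝟙 _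

variable {c} in
/-- The diagram `(D⁵, u⁴ ∘ u⁷, u⁶ ∘ u⁸, μ, g ∘ lam)`. -/
def WhiskerData.diagram (hW : AdmitsBicalculus W) {r : TwoMorData f₁ f₂} {g : Mor W B X}
    (F : WhiskerData c r g) : TwoMorData (f₁.comp hW c g) (f₂.comp hW c g) where
  A₃ := F.η₃.D
  v₁ := F.η₃.leg ≫ F.η₁.top
  v₂ := F.η₃.top ≫ F.η₂.top
  mem := by
    refine hW.iso_mem _ _ (hW.comp_mem _ _ F.η₃.leg_mem (hW.comp_mem _ _ F.η₁.leg_mem r.mem))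
      ⟨α_ _ _ _ ≪≫ whiskerLeftIso _ ((α_ _ _ _).symm ≪≫ whiskerRightIso F.η₁.ρ.symm _ ≪≫
        α_ _ _ _)⟩
  α := mu c r g F.η₁ F.η₂ F.η₃
  β := F.gLam

/-- The data obtained from the sets of choices `C(W)` and `D(W)`: first `η₁`, `η₂` and
`s = (R, p⁷, p⁸, η̃³)` are chosen by `C(W)`; then `D(W)` provides `q : D⁵ ⟶ R` in `W` and `lam`,
and one sets `u⁷ = p⁷ ∘ q`, `u⁸ = p⁸ ∘ q`, `η³ = η̃³ ∘ q`. -/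
def WhiskerData.ofChoices (hW : AdmitsBicalculus W) (d : ChoicesD W) (r : TwoMorData f₁ f₂)
    (g : Mor W B X) : WhiskerData c r g :=
  let e₁ := c r.v₁ (c f₁.f g.w g.w_mem).leg (c f₁.f g.w g.w_mem).leg_mem
  let e₂ := c r.v₂ (c f₂.f g.w g.w_mem).leg (c f₂.f g.w g.w_mem).leg_mem
  let s := c e₁.leg e₂.leg e₂.leg_mem
  let l := d g.w g.w_mem _ _ (pasting c r g e₁ e₂ s)
  { η₁ := e₁
    η₂ := e₂
    η₃ :=
      { D := l.D
        leg := l.v ≫ s.leg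
        leg_mem := hW.comp_mem _ _ l.v_mem s.leg_mem
        top := l.v ≫ s.top
        ρ := α_ _ _ _ ≪≫ whiskerLeftIso l.v s.ρ ≪≫ (α_ _ _ _).symm }
    lam := (α_ _ _ _).hom ≫ l.β ≫ (α_ _ _ _).inv
    lam_eq := by
      have h := l.isLift
      unfold IsLift at h
      have h' : l.β ▷ g.w = (α_ _ _ _).hom ≫ l.v ◁ pasting c r g e₁ e₂ s ≫ (α_ _ _ _).inv := by
        rw [h]; simp
      rw [comp_whiskerRight, comp_whiskerRight, h']
      simp only [pasting, Iso.trans_hom, whiskerLeftIso_hom, Iso.symm_hom]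
      bicategory }

/-- The horizontal composition `g ∘ Γ` in the bicategory of fractions determined by the sets of
choices `C(W)` and `D(W)`: the class of the diagram that these choices produce from a chosen
representative of `Γ`. -/
def TwoMor.whisker {hW : AdmitsBicalculus W} (d : ChoicesD W) (Γ : TwoMor hW f₁ f₂)
    (g : Mor W B X) : TwoMor hW (f₁.comp hW c g) (f₂.comp hW c g) :=
  ((WhiskerData.ofChoices c hW d (Quotient.out Γ) g).diagram hW).toTwoMor hW

end Whisker

end BicategoryOfFractions

end

open BicategoryOfFractions

noncomputable section

namespace BicategoryOfFractions

variable {C : Type u} [Bicategory.{w, v} C]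

/-! The core is claim 2, for equivalent representatives `r`, `r'`. Data (F8)–(F10) enter only
through `a = u³u⁷` in `W`, the legs `s₁ = u⁴u⁷`, `s₂ = u⁶u⁸`, and invertible `φ₁ : u¹s₁ ⇒ v¹a`, `φ₂
: v²a ⇒ u²s₂`. By interchange, `μ` is the transport of `α` along `φ₁`, `φ₂`, and `u ∘ λ` is the
transport of `β` conjugated by `ρ¹`, `ρ²` (`mu_hom`, `lamAssoc_whiskerRight`).

Pulling `a`, `a'` back to the object `A⁴` that witnesses `r ~ r'` gives a common `T`. Over `T`, the
given `σ¹`, `σ²` induce comparisons of the legs whiskered with `u¹`, `u²`, and these respect the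
transports (`comparison_transport`). As `u¹`, `u²` are in `W`, both comparisons lift to the legs
themselves over some `M ⟶ T` in `W`.

The compatibility for `μ` then holds over `M`. The one for `λ` holds only after whiskering with `u`;
since `u` is in `W`, `exists_whiskerLeft_eq` gives it over some `N ⟶ M` in `W`, where it can be
whiskered with `g`. -/

/-! ### Lifting and cancelling along `W`. -/

/-- 2-morphisms that agree after whiskering with a morphism of `W` agree after a restriction. -/
theorem AdmitsBicalculus.exists_whiskerLeft_eq {W : MorphismProperty C} (hW : AdmitsBicalculus W)
    {A B X : C} {k : B ⟶ A} (hk : W k) {f₁ f₂ : X ⟶ B} (β β' : f₁ ⟶ f₂)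
    (h : β ▷ k = β' ▷ k) : ∃ (E : C) (p : E ⟶ X), W p ∧ p ◁ β = p ◁ β' := by
  -- Hence `β` and `β'` are two lifts, along the identity, of the same 2-morphism `β ▷ k`, and
  -- uniqueness of lifts compares them.
  have key : ∀ γ : f₁ ⟶ f₂, IsLift (γ ▷ k) (𝟙 X) (𝟙 X ◁ γ) := fun γ => by
    unfold IsLift
    rw [whisker_assoc]
    simp
  obtain ⟨E, p, p', ζ, hp, e⟩ := hW.lift_unique k hk f₁ f₂ (β ▷ k) (𝟙 X) (𝟙 X) _ _
    (hW.id_mem X) (hW.id_mem X) (key β) (h ▸ key β')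
  -- Uniqueness of lifts puts only the composite `p ≫ 𝟙 X` in `W`, not `p`.
  refine ⟨E, p ≫ 𝟙 X, hp, ?_⟩
  -- The comparison `ζ` of the two restrictions slides past `β'` by interchange, so it cancels.
  rw [← cancel_mono (ζ.hom ▷ f₂)]
  simp only [comp_whiskerLeft, Category.assoc] at e ⊢
  rw [← e]
  have := whisker_exchange ζ.hom β'
  simp only [comp_whiskerLeft, Category.assoc] at this
  exact this.symm

/-- Invertible 2-morphisms lift along `W`. -/
theorem AdmitsBicalculus.exists_iso_lift {W : MorphismProperty C} (hW : AdmitsBicalculus W)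
    {A B X : C} {k : B ⟶ A} (hk : W k) {s s' : X ⟶ B} (κ : s ≫ k ≅ s' ≫ k) :
    ∃ (D : C) (q : D ⟶ X) (τ : q ≫ s ≅ q ≫ s'), W q ∧
      τ.hom ▷ k = (α_ q s k).hom ≫ q ◁ κ.hom ≫ (α_ q s' k).inv := by
  obtain ⟨D, q, β, hq, hβ, hi⟩ := hW.exists_lift k hk s s' κ.hom
  have := hi inferInstance
  unfold IsLift at hβ
  exact ⟨D, q, asIso β, hq, by simp [hβ]⟩

/-- Two invertible 2-morphisms can be lifted along `W` over a common object. -/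
theorem AdmitsBicalculus.exists_iso_lift₂ {W : MorphismProperty C} (hW : AdmitsBicalculus W)
    {X A₁ B₁ A₂ B₂ : C} {k₁ : B₁ ⟶ A₁} {k₂ : B₂ ⟶ A₂} (h₁ : W k₁) (h₂ : W k₂)
    {s₁ s₁' : X ⟶ B₁} {s₂ s₂' : X ⟶ B₂} (κ₁ : s₁ ≫ k₁ ≅ s₁' ≫ k₁) (κ₂ : s₂ ≫ k₂ ≅ s₂' ≫ k₂) :
    ∃ (D : C) (q : D ⟶ X) (τ₁ : q ≫ s₁ ≅ q ≫ s₁') (τ₂ : q ≫ s₂ ≅ q ≫ s₂'), W q ∧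
      τ₁.hom ▷ k₁ = (α_ q s₁ k₁).hom ≫ q ◁ κ₁.hom ≫ (α_ q s₁' k₁).inv ∧
      τ₂.hom ▷ k₂ = (α_ q s₂ k₂).hom ≫ q ◁ κ₂.hom ≫ (α_ q s₂' k₂).inv := by
  obtain ⟨D, q, τ, hq, e⟩ := hW.exists_iso_lift h₁ κ₁
  -- The second lift is taken of `κ₂` already restricted along `q`, so that both live over `D'`.
  obtain ⟨D', q', τ', hq', e'⟩ := hW.exists_iso_lift h₂
    (α_ q s₂ k₂ ≪≫ whiskerLeftIso q κ₂ ≪≫ (α_ q s₂' k₂).symm)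
  refine ⟨D', q' ≫ q, α_ _ _ _ ≪≫ whiskerLeftIso q' τ ≪≫ (α_ _ _ _).symm,
    α_ _ _ _ ≪≫ τ' ≪≫ (α_ _ _ _).symm, hW.comp_mem _ _ hq' hq, ?_, ?_⟩
  · calc
      _ = 𝟙 _ ⊗≫ q' ◁ (τ.hom ▷ k₁) ⊗≫ 𝟙 _ := by
        simp only [Iso.trans_hom, whiskerLeftIso_hom, Iso.symm_hom]
        bicategory
      _ = _ := by
        rw [e]
        bicategory
  · calc
      _ = 𝟙 _ ⊗≫ (τ'.hom ▷ k₂) ⊗≫ 𝟙 _ := by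
        simp only [Iso.trans_hom, Iso.symm_hom]
        bicategory
      _ = _ := by
        rw [e']
        simp only [Iso.trans_hom, whiskerLeftIso_hom, Iso.symm_hom]
        bicategory

/-- Two morphisms of `W` with targets the ends of a span can be pulled back to the span. -/
theorem AdmitsBicalculus.exists_span {W : MorphismProperty C} (hW : AdmitsBicalculus W)
    {A₃ A₃' A₄ E E' : C} {a : E ⟶ A₃} {a' : E' ⟶ A₃'} (ha : W a) (ha' : W a')
    (z : A₄ ⟶ A₃) (z' : A₄ ⟶ A₃') :
    ∃ (T : C) (x : T ⟶ A₄) (t : T ⟶ E) (t' : T ⟶ E'), W x ∧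
      Nonempty (x ≫ z ≅ t ≫ a) ∧ Nonempty (x ≫ z' ≅ t' ≫ a') := by
  obtain ⟨P, p, f, hp, ⟨κ⟩⟩ := hW.exists_square a z ha
  -- The second square is built over `P`, so the first one only has to be restricted along `p'`.
  obtain ⟨P', p', f', hp', ⟨κ'⟩⟩ := hW.exists_square a' (p ≫ z') ha'
  exact ⟨P', p' ≫ p, p' ≫ f, f', hW.comp_mem _ _ hp' hp,
    ⟨α_ _ _ _ ≪≫ whiskerLeftIso p' κ ≪≫ (α_ _ _ _).symm⟩, ⟨α_ _ _ _ ≪≫ κ'⟩⟩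

/-! ### Transport of 2-morphisms and comparison of legs. -/

/-- The 2-morphism `u₁ k₁ s₁ ⇒ v₁ k₁ a ⇒ v₂ k₂ a ⇒ u₂ k₂ s₂` obtained from `γ` by transport along
`φ₁` and `φ₂`. -/
def transport {A₃ E X₁ X₂ D₁ D₂ Y : C} {v₁ : A₃ ⟶ X₁} {v₂ : A₃ ⟶ X₂} {k₁ : X₁ ⟶ Y} {k₂ : X₂ ⟶ Y}
    {u₁ : D₁ ⟶ X₁} {u₂ : D₂ ⟶ X₂} {a : E ⟶ A₃} {s₁ : E ⟶ D₁} {s₂ : E ⟶ D₂}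
    (φ₁ : s₁ ≫ u₁ ≅ a ≫ v₁) (φ₂ : a ≫ v₂ ≅ s₂ ≫ u₂) (γ : v₁ ≫ k₁ ⟶ v₂ ≫ k₂) :
    s₁ ≫ u₁ ≫ k₁ ⟶ s₂ ≫ u₂ ≫ k₂ :=
  𝟙 _ ⊗≫ φ₁.hom ▷ k₁ ⊗≫ a ◁ γ ⊗≫ φ₂.hom ▷ k₂ ⊗≫ 𝟙 _

section Comparison

variable {A₃ A₃' A₄ E E' T M X₁ X₂ D₁ D₂ Y : C}
  {v₁ : A₃ ⟶ X₁} {v₂ : A₃ ⟶ X₂} {v₁' : A₃' ⟶ X₁} {v₂' : A₃' ⟶ X₂}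
  {u₁ : D₁ ⟶ X₁} {u₂ : D₂ ⟶ X₂}
  {a : E ⟶ A₃} {s₁ : E ⟶ D₁} {s₂ : E ⟶ D₂} {a' : E' ⟶ A₃'} {s₁' : E' ⟶ D₁} {s₂' : E' ⟶ D₂}
  {z : A₄ ⟶ A₃} {z' : A₄ ⟶ A₃'} {x : T ⟶ A₄} {t : T ⟶ E} {t' : T ⟶ E'}
  (φ₁ : s₁ ≫ u₁ ≅ a ≫ v₁) (φ₂ : a ≫ v₂ ≅ s₂ ≫ u₂)
  (φ₁' : s₁' ≫ u₁ ≅ a' ≫ v₁') (φ₂' : a' ≫ v₂' ≅ s₂' ≫ u₂)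
  (θ : x ≫ z ≅ t ≫ a) (θ' : x ≫ z' ≅ t' ≫ a')
  (σ₁ : z' ≫ v₁' ≅ z ≫ v₁) (σ₂ : z ≫ v₂ ≅ z' ≫ v₂')

/-- The comparison of the first legs. -/
def comparison₁ : (t' ≫ s₁') ≫ u₁ ≅ (t ≫ s₁) ≫ u₁ :=
  α_ _ _ _ ≪≫ whiskerLeftIso t' φ₁' ≪≫ (α_ _ _ _).symm ≪≫ whiskerRightIso θ'.symm v₁' ≪≫
    α_ _ _ _ ≪≫ whiskerLeftIso x σ₁ ≪≫ (α_ _ _ _).symm ≪≫ whiskerRightIso θ v₁ ≪≫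
    α_ _ _ _ ≪≫ whiskerLeftIso t φ₁.symm ≪≫ (α_ _ _ _).symm

/-- The comparison of the second legs. -/
def comparison₂ : (t ≫ s₂) ≫ u₂ ≅ (t' ≫ s₂') ≫ u₂ :=
  α_ _ _ _ ≪≫ whiskerLeftIso t φ₂.symm ≪≫ (α_ _ _ _).symm ≪≫ whiskerRightIso θ.symm v₂ ≪≫
    α_ _ _ _ ≪≫ whiskerLeftIso x σ₂ ≪≫ (α_ _ _ _).symm ≪≫ whiskerRightIso θ' v₂' ≪≫
    α_ _ _ _ ≪≫ whiskerLeftIso t' φ₂' ≪≫ (α_ _ _ _).symm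

/-- The `φ₁`, `φ₂` of the transport meet their inverses in the comparisons, and `θ` cancels against
its inverse across `γ` by interchange. This leaves `h` restricted along `x`; `θ'` then cancels in
the same way across `γ'`. Leaving `k₁`, `k₂` free covers `α` and `β` at once. -/
theorem comparison_transport {k₁ : X₁ ⟶ Y} {k₂ : X₂ ⟶ Y}
    {γ : v₁ ≫ k₁ ⟶ v₂ ≫ k₂} {γ' : v₁' ≫ k₁ ⟶ v₂' ≫ k₂}
    (h : σ₁.hom ▷ k₁ ≫ (α_ z v₁ k₁).hom ≫ z ◁ γ ≫ (α_ z v₂ k₂).inv ≫ σ₂.hom ▷ k₂ =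
      (α_ z' v₁' k₁).hom ≫ z' ◁ γ' ≫ (α_ z' v₂' k₂).inv) :
    (comparison₁ φ₁ φ₁' θ θ' σ₁).hom ▷ k₁ ⊗≫ t ◁ transport φ₁ φ₂ γ ⊗≫
      (comparison₂ φ₂ φ₂' θ θ' σ₂).hom ▷ k₂ =
      𝟙 _ ⊗≫ t' ◁ transport φ₁' φ₂' γ' ⊗≫ 𝟙 _ := by
  have e : θ.hom ▷ (v₁ ≫ k₁) ≫ (t ≫ a) ◁ γ ≫ θ.inv ▷ (v₂ ≫ k₂) = (x ≫ z) ◁ γ := by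
    rw [← whisker_exchange_assoc]
    simp
  have e' : θ'.inv ▷ (v₁' ≫ k₁) ≫ (x ≫ z') ◁ γ' ≫ θ'.hom ▷ (v₂' ≫ k₂) = (t' ≫ a') ◁ γ' := by
    rw [← whisker_exchange_assoc]
    simp
  have c₁ : φ₁.inv ≫ φ₁.hom = 𝟙 _ := by simp
  have c₂ : φ₂.hom ≫ φ₂.inv = 𝟙 _ := by simp
  calc
    _ = 𝟙 _ ⊗≫ t' ◁ φ₁'.hom ▷ k₁ ⊗≫ θ'.inv ▷ (v₁' ≫ k₁) ⊗≫ x ◁ σ₁.hom ▷ k₁ ⊗≫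
        θ.hom ▷ (v₁ ≫ k₁) ⊗≫ t ◁ (φ₁.inv ≫ φ₁.hom) ▷ k₁ ⊗≫ (t ≫ a) ◁ γ ⊗≫
        t ◁ (φ₂.hom ≫ φ₂.inv) ▷ k₂ ⊗≫ θ.inv ▷ (v₂ ≫ k₂) ⊗≫ x ◁ σ₂.hom ▷ k₂ ⊗≫
        θ'.hom ▷ (v₂' ≫ k₂) ⊗≫ t' ◁ φ₂'.hom ▷ k₂ ⊗≫ 𝟙 _ := by
      simp only [comparison₁, comparison₂, transport, Iso.trans_hom, whiskerLeftIso_hom,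
        whiskerRightIso_hom, Iso.symm_hom]
      bicategory
    _ = 𝟙 _ ⊗≫ t' ◁ φ₁'.hom ▷ k₁ ⊗≫ θ'.inv ▷ (v₁' ≫ k₁) ⊗≫ x ◁ σ₁.hom ▷ k₁ ⊗≫
        (θ.hom ▷ (v₁ ≫ k₁) ≫ (t ≫ a) ◁ γ ≫ θ.inv ▷ (v₂ ≫ k₂)) ⊗≫ x ◁ σ₂.hom ▷ k₂ ⊗≫
        θ'.hom ▷ (v₂' ≫ k₂) ⊗≫ t' ◁ φ₂'.hom ▷ k₂ ⊗≫ 𝟙 _ := by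
      rw [c₁, c₂]
      bicategory
    _ = 𝟙 _ ⊗≫ t' ◁ φ₁'.hom ▷ k₁ ⊗≫ θ'.inv ▷ (v₁' ≫ k₁) ⊗≫
        x ◁ (σ₁.hom ▷ k₁ ≫ (α_ z v₁ k₁).hom ≫ z ◁ γ ≫ (α_ z v₂ k₂).inv ≫ σ₂.hom ▷ k₂) ⊗≫
        θ'.hom ▷ (v₂' ≫ k₂) ⊗≫ t' ◁ φ₂'.hom ▷ k₂ ⊗≫ 𝟙 _ := by
      rw [e]
      bicategory
    _ = 𝟙 _ ⊗≫ t' ◁ φ₁'.hom ▷ k₁ ⊗≫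
        (θ'.inv ▷ (v₁' ≫ k₁) ≫ (x ≫ z') ◁ γ' ≫ θ'.hom ▷ (v₂' ≫ k₂)) ⊗≫
        t' ◁ φ₂'.hom ▷ k₂ ⊗≫ 𝟙 _ := by
      rw [h]
      bicategory
    _ = _ := by
      rw [e']
      simp only [transport]
      bicategory

/-- The compatibility of lifted comparisons with transported 2-morphisms. -/
theorem lift_comparison_transport {k₁ : X₁ ⟶ Y} {k₂ : X₂ ⟶ Y} {m : M ⟶ T}
    {γ : v₁ ≫ k₁ ⟶ v₂ ≫ k₂} {γ' : v₁' ≫ k₁ ⟶ v₂' ≫ k₂}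
    (h : σ₁.hom ▷ k₁ ≫ (α_ z v₁ k₁).hom ≫ z ◁ γ ≫ (α_ z v₂ k₂).inv ≫ σ₂.hom ▷ k₂ =
      (α_ z' v₁' k₁).hom ≫ z' ◁ γ' ≫ (α_ z' v₂' k₂).inv)
    (τ₁ : m ≫ t' ≫ s₁' ≅ m ≫ t ≫ s₁) (τ₂ : m ≫ t ≫ s₂ ≅ m ≫ t' ≫ s₂')
    (h₁ : τ₁.hom ▷ u₁ = (α_ _ _ _).hom ≫ m ◁ (comparison₁ φ₁ φ₁' θ θ' σ₁).hom ≫ (α_ _ _ _).inv)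
    (h₂ : τ₂.hom ▷ u₂ = (α_ _ _ _).hom ≫ m ◁ (comparison₂ φ₂ φ₂' θ θ' σ₂).hom ≫ (α_ _ _ _).inv) :
    (α_ m t' s₁' ≪≫ τ₁ ≪≫ (α_ m t s₁).symm).hom ▷ (u₁ ≫ k₁) ≫ (α_ (m ≫ t) s₁ (u₁ ≫ k₁)).hom ≫
        (m ≫ t) ◁ transport φ₁ φ₂ γ ≫ (α_ (m ≫ t) s₂ (u₂ ≫ k₂)).inv ≫
        (α_ m t s₂ ≪≫ τ₂ ≪≫ (α_ m t' s₂').symm).hom ▷ (u₂ ≫ k₂) =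
      (α_ (m ≫ t') s₁' (u₁ ≫ k₁)).hom ≫ (m ≫ t') ◁ transport φ₁' φ₂' γ' ≫
        (α_ (m ≫ t') s₂' (u₂ ≫ k₂)).inv := by
  calc
    _ = 𝟙 _ ⊗≫ (τ₁.hom ▷ u₁) ▷ k₁ ⊗≫ (m ≫ t) ◁ transport φ₁ φ₂ γ ⊗≫ (τ₂.hom ▷ u₂) ▷ k₂ ⊗≫ 𝟙 _ := by
      simp only [Iso.trans_hom, Iso.symm_hom]
      bicategory
    -- Whiskered with `u₁`, `u₂`, the lifts `τ₁`, `τ₂` become the comparisons restricted along `m`.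
    _ = 𝟙 _ ⊗≫ m ◁ ((comparison₁ φ₁ φ₁' θ θ' σ₁).hom ▷ k₁ ⊗≫ t ◁ transport φ₁ φ₂ γ ⊗≫
      (comparison₂ φ₂ φ₂' θ θ' σ₂).hom ▷ k₂) ⊗≫ 𝟙 _ := by
      rw [h₁, h₂]
      bicategory
    _ = _ := by
      rw [comparison_transport _ _ _ _ _ _ _ _ h]
      bicategory

end Comparison

/-! ### Conjugation and restriction of compatibilities. -/

/-- Conjugation by `ρ₁`, `ρ₂` is compatible with `τ₁`, `τ₂`. -/
theorem lift_comparison_conj {M E E' D₁ D₂ B' Y : C} {p : M ⟶ E} {p' : M ⟶ E'}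
    {s₁ : E ⟶ D₁} {s₂ : E ⟶ D₂} {s₁' : E' ⟶ D₁} {s₂' : E' ⟶ D₂}
    {j₁ : D₁ ⟶ Y} {j₂ : D₂ ⟶ Y} {h₁ : D₁ ⟶ B'} {h₂ : D₂ ⟶ B'} {k : B' ⟶ Y}
    (ρ₁ : j₁ ≅ h₁ ≫ k) (ρ₂ : j₂ ≅ h₂ ≫ k) {δ : s₁ ≫ j₁ ⟶ s₂ ≫ j₂} {δ' : s₁' ≫ j₁ ⟶ s₂' ≫ j₂}
    (τ₁ : p' ≫ s₁' ≅ p ≫ s₁) (τ₂ : p ≫ s₂ ≅ p' ≫ s₂')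
    (h : τ₁.hom ▷ j₁ ≫ (α_ p s₁ j₁).hom ≫ p ◁ δ ≫ (α_ p s₂ j₂).inv ≫ τ₂.hom ▷ j₂ =
      (α_ p' s₁' j₁).hom ≫ p' ◁ δ' ≫ (α_ p' s₂' j₂).inv)
    {l : s₁ ≫ h₁ ⟶ s₂ ≫ h₂} {l' : s₁' ≫ h₁ ⟶ s₂' ≫ h₂}
    (hl : l ▷ k = (α_ s₁ h₁ k).hom ≫ s₁ ◁ ρ₁.inv ≫ δ ≫ s₂ ◁ ρ₂.hom ≫ (α_ s₂ h₂ k).inv)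
    (hl' : l' ▷ k = (α_ s₁' h₁ k).hom ≫ s₁' ◁ ρ₁.inv ≫ δ' ≫ s₂' ◁ ρ₂.hom ≫ (α_ s₂' h₂ k).inv) :
    (τ₁.hom ▷ h₁ ≫ (α_ p s₁ h₁).hom ≫ p ◁ l ≫ (α_ p s₂ h₂).inv ≫ τ₂.hom ▷ h₂) ▷ k =
      ((α_ p' s₁' h₁).hom ≫ p' ◁ l' ≫ (α_ p' s₂' h₂).inv) ▷ k := by
  calc
    _ = 𝟙 _ ⊗≫ τ₁.hom ▷ (h₁ ≫ k) ⊗≫ p ◁ (l ▷ k) ⊗≫ τ₂.hom ▷ (h₂ ≫ k) ⊗≫ 𝟙 _ := by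
      bicategory
    _ = 𝟙 _ ⊗≫ (τ₁.hom ▷ (h₁ ≫ k) ≫ (p ≫ s₁) ◁ ρ₁.inv) ⊗≫ p ◁ δ ⊗≫
        ((p ≫ s₂) ◁ ρ₂.hom ≫ τ₂.hom ▷ (h₂ ≫ k)) ⊗≫ 𝟙 _ := by
      rw [hl]
      bicategory
    _ = 𝟙 _ ⊗≫ (p' ≫ s₁') ◁ ρ₁.inv ⊗≫
        (τ₁.hom ▷ j₁ ≫ (α_ p s₁ j₁).hom ≫ p ◁ δ ≫ (α_ p s₂ j₂).inv ≫ τ₂.hom ▷ j₂) ⊗≫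
        (p' ≫ s₂') ◁ ρ₂.hom ⊗≫ 𝟙 _ := by
      -- Interchange moves `ρ₁`, `ρ₂` outwards past `τ₁`, `τ₂`, which exposes the left side of `h`.
      rw [← whisker_exchange, whisker_exchange τ₂.hom]
      bicategory
    _ = 𝟙 _ ⊗≫ p' ◁ ((α_ s₁' h₁ k).hom ≫ s₁' ◁ ρ₁.inv ≫ δ' ≫ s₂' ◁ ρ₂.hom ≫
        (α_ s₂' h₂ k).inv) ⊗≫ 𝟙 _ := by
      rw [h]
      bicategory
    _ = _ := by
      rw [← hl']
      bicategory

/-- Restriction of a compatibility along `n`. -/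
theorem restrict_compat {N M E E' D₁ D₂ Y : C} (n : N ⟶ M) {p : M ⟶ E} {p' : M ⟶ E'}
    {s₁ : E ⟶ D₁} {s₂ : E ⟶ D₂} {s₁' : E' ⟶ D₁} {s₂' : E' ⟶ D₂}
    {h₁ : D₁ ⟶ Y} {h₂ : D₂ ⟶ Y}
    (τ₁ : p' ≫ s₁' ≅ p ≫ s₁) (τ₂ : p ≫ s₂ ≅ p' ≫ s₂')
    {l : s₁ ≫ h₁ ⟶ s₂ ≫ h₂} {l' : s₁' ≫ h₁ ⟶ s₂' ≫ h₂}
    (h : n ◁ (τ₁.hom ▷ h₁ ≫ (α_ p s₁ h₁).hom ≫ p ◁ l ≫ (α_ p s₂ h₂).inv ≫ τ₂.hom ▷ h₂) =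
      n ◁ ((α_ p' s₁' h₁).hom ≫ p' ◁ l' ≫ (α_ p' s₂' h₂).inv)) :
    (α_ n p' s₁' ≪≫ whiskerLeftIso n τ₁ ≪≫ (α_ n p s₁).symm).hom ▷ h₁ ≫
      (α_ (n ≫ p) s₁ h₁).hom ≫ (n ≫ p) ◁ l ≫ (α_ (n ≫ p) s₂ h₂).inv ≫
      (α_ n p s₂ ≪≫ whiskerLeftIso n τ₂ ≪≫ (α_ n p' s₂').symm).hom ▷ h₂ =
      (α_ (n ≫ p') s₁' h₁).hom ≫ (n ≫ p') ◁ l' ≫ (α_ (n ≫ p') s₂' h₂).inv := by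
  calc
    _ = 𝟙 _ ⊗≫ n ◁ (τ₁.hom ▷ h₁ ≫ (α_ p s₁ h₁).hom ≫ p ◁ l ≫ (α_ p s₂ h₂).inv ≫
        τ₂.hom ▷ h₂) ⊗≫ 𝟙 _ := by
      simp only [Iso.trans_hom, whiskerLeftIso_hom, Iso.symm_hom]
      bicategory
    _ = _ := by
      rw [h]
      bicategory

/-! ### The data (F8)–(F10) in terms of transports. -/

namespace WhiskerData

variable {W : MorphismProperty C} {c : ChoicesC W} {A B X : C} {f₁ f₂ : Mor W A B}
  {r : TwoMorData f₁ f₂} {g : Mor W B X} (F : WhiskerData c r g)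

/-- The invertible 2-morphism `u¹ u⁴ u⁷ ⇒ v¹ u³ u⁷`. -/
def φ₁ : (F.η₃.leg ≫ F.η₁.top) ≫ (c f₁.f g.w g.w_mem).leg ≅ (F.η₃.leg ≫ F.η₁.leg) ≫ r.v₁ :=
  α_ _ _ _ ≪≫ whiskerLeftIso F.η₃.leg F.η₁.ρ.symm ≪≫ (α_ _ _ _).symm

/-- The invertible 2-morphism `v² u³ u⁷ ⇒ u² u⁶ u⁸`. -/
def φ₂ : (F.η₃.leg ≫ F.η₁.leg) ≫ r.v₂ ≅ (F.η₃.top ≫ F.η₂.top) ≫ (c f₂.f g.w g.w_mem).leg :=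
  whiskerRightIso F.η₃.ρ r.v₂ ≪≫ α_ _ _ _ ≪≫ whiskerLeftIso F.η₃.top F.η₂.ρ ≪≫ (α_ _ _ _).symm

/-- The 2-morphism `lam` with the sources and targets of the diagram. -/
def lamAssoc : (F.η₃.leg ≫ F.η₁.top) ≫ (c f₁.f g.w g.w_mem).top ⟶
    (F.η₃.top ≫ F.η₂.top) ≫ (c f₂.f g.w g.w_mem).top :=
  (α_ _ _ _).hom ≫ F.lam ≫ (α_ _ _ _).inv

/-- In `mu` the square `η₃` is applied before `α`, whereas in the transport it belongs to `φ₂` and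
comes after; interchange reconciles the two. -/
theorem mu_hom : (mu c r g F.η₁ F.η₂ F.η₃).hom = transport F.φ₁ F.φ₂ r.α.hom := by
  calc
    _ = 𝟙 _ ⊗≫ F.η₃.leg ◁ F.η₁.ρ.inv ▷ f₁.w ⊗≫
        (F.η₃.ρ.hom ▷ (r.v₁ ≫ f₁.w) ≫ (F.η₃.top ≫ F.η₂.leg) ◁ r.α.hom) ⊗≫
        F.η₃.top ◁ F.η₂.ρ.hom ▷ f₂.w ⊗≫ 𝟙 _ := by
      simp only [mu, bicategoricalIsoComp, Iso.trans_hom, whiskerLeftIso_hom,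
        whiskerRightIso_hom, Iso.symm_hom, Iso.refl_hom]
      bicategory
    _ = _ := by
      rw [← whisker_exchange]
      simp only [transport, φ₁, φ₂, Iso.trans_hom, whiskerLeftIso_hom, whiskerRightIso_hom,
        Iso.symm_hom]
      bicategory

/-- The same interchange of `η₃`, now with `β`, puts the pasting in the form required by
`lift_comparison_conj`. -/
theorem lamAssoc_whiskerRight : F.lamAssoc ▷ g.w =
    (α_ _ _ _).hom ≫ (F.η₃.leg ≫ F.η₁.top) ◁ (c f₁.f g.w g.w_mem).ρ.inv ≫
      transport F.φ₁ F.φ₂ r.β ≫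
      (F.η₃.top ≫ F.η₂.top) ◁ (c f₂.f g.w g.w_mem).ρ.hom ≫ (α_ _ _ _).inv := by
  calc
    _ = 𝟙 _ ⊗≫ F.lam ▷ g.w ⊗≫ 𝟙 _ := by
      simp only [lamAssoc]
      bicategory
    _ = 𝟙 _ ⊗≫ (F.η₃.leg ≫ F.η₁.top) ◁ (c f₁.f g.w g.w_mem).ρ.inv ⊗≫
        F.η₃.leg ◁ F.η₁.ρ.inv ▷ f₁.f ⊗≫
        (F.η₃.ρ.hom ▷ (r.v₁ ≫ f₁.f) ≫ (F.η₃.top ≫ F.η₂.leg) ◁ r.β) ⊗≫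
        F.η₃.top ◁ F.η₂.ρ.hom ▷ f₂.f ⊗≫
        (F.η₃.top ≫ F.η₂.top) ◁ (c f₂.f g.w g.w_mem).ρ.hom ⊗≫ 𝟙 _ := by
      rw [F.lam_eq, pasting]
      bicategory
    _ = _ := by
      rw [← whisker_exchange]
      simp only [transport, φ₁, φ₂, Iso.trans_hom, whiskerLeftIso_hom, whiskerRightIso_hom,
        Iso.symm_hom]
      bicategory

theorem gLam_eq : F.gLam = (α_ _ _ _).inv ≫ F.lamAssoc ▷ g.f ≫ (α_ _ _ _).hom := by
  simp only [gLam, lamAssoc]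
  bicategory

end WhiskerData

/-! ### Equivalence of the whiskered diagrams. -/

/-- Whiskering of a compatibility with `k`. -/
theorem whiskerRight_compat {M E E' D₁ D₂ B' Y : C} {p : M ⟶ E} {p' : M ⟶ E'}
    {s₁ : E ⟶ D₁} {s₂ : E ⟶ D₂} {s₁' : E' ⟶ D₁} {s₂' : E' ⟶ D₂}
    {h₁ : D₁ ⟶ B'} {h₂ : D₂ ⟶ B'} (k : B' ⟶ Y)
    (τ₁ : p' ≫ s₁' ≅ p ≫ s₁) (τ₂ : p ≫ s₂ ≅ p' ≫ s₂')
    {l : s₁ ≫ h₁ ⟶ s₂ ≫ h₂} {l' : s₁' ≫ h₁ ⟶ s₂' ≫ h₂}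
    (h : τ₁.hom ▷ h₁ ≫ (α_ p s₁ h₁).hom ≫ p ◁ l ≫ (α_ p s₂ h₂).inv ≫ τ₂.hom ▷ h₂ =
      (α_ p' s₁' h₁).hom ≫ p' ◁ l' ≫ (α_ p' s₂' h₂).inv) :
    τ₁.hom ▷ (h₁ ≫ k) ≫ (α_ p s₁ (h₁ ≫ k)).hom ≫
        p ◁ ((α_ _ _ _).inv ≫ l ▷ k ≫ (α_ _ _ _).hom) ≫
        (α_ p s₂ (h₂ ≫ k)).inv ≫ τ₂.hom ▷ (h₂ ≫ k) =
      (α_ p' s₁' (h₁ ≫ k)).hom ≫ p' ◁ ((α_ _ _ _).inv ≫ l' ▷ k ≫ (α_ _ _ _).hom) ≫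
        (α_ p' s₂' (h₂ ≫ k)).inv := by
  calc
    _ = 𝟙 _ ⊗≫ (τ₁.hom ▷ h₁ ≫ (α_ p s₁ h₁).hom ≫ p ◁ l ≫ (α_ p s₂ h₂).inv ≫ τ₂.hom ▷ h₂) ▷ k
        ⊗≫ 𝟙 _ := by
      bicategory
    _ = _ := by
      rw [h]
      bicategory

/-- Equivalent data give equivalent whiskered diagrams. -/
theorem WhiskerData.diagram_equivalent {W : MorphismProperty C} (hW : AdmitsBicalculus W)
    {c : ChoicesC W} {A B X : C} {f₁ f₂ : Mor W A B} {r r' : TwoMorData f₁ f₂} {g : Mor W B X}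
    (hr : r.Equivalent r') (F : WhiskerData c r g) (F' : WhiskerData c r' g) :
    (F.diagram hW).Equivalent (F'.diagram hW) := by
  obtain ⟨A₄, z, z', σ₁, σ₂, hz, hα, hβ⟩ := hr
  obtain ⟨T, x, t, t', hx, ⟨θ⟩, ⟨θ'⟩⟩ := hW.exists_span
    (hW.comp_mem _ _ F.η₃.leg_mem F.η₁.leg_mem) (hW.comp_mem _ _ F'.η₃.leg_mem F'.η₁.leg_mem) z z'
  obtain ⟨M, m, τ₁, τ₂, hm, e₁, e₂⟩ := hW.exists_iso_lift₂
    (c f₁.f g.w g.w_mem).leg_mem (c f₂.f g.w g.w_mem).leg_mem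
    (comparison₁ F.φ₁ F'.φ₁ θ θ' σ₁) (comparison₂ F.φ₂ F'.φ₂ θ θ' σ₂)
  have hα' := lift_comparison_transport F.φ₁ F.φ₂ F'.φ₁ F'.φ₂ θ θ' σ₁ σ₂ hα τ₁ τ₂ e₁ e₂
  have hβ' := lift_comparison_transport F.φ₁ F.φ₂ F'.φ₁ F'.φ₂ θ θ' σ₁ σ₂ hβ τ₁ τ₂ e₁ e₂
  obtain ⟨N, n, hn, e⟩ := hW.exists_whiskerLeft_eq g.w_mem _ _
    (lift_comparison_conj (c f₁.f g.w g.w_mem).ρ (c f₂.f g.w g.w_mem).ρ _ _ hβ'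
      F.lamAssoc_whiskerRight F'.lamAssoc_whiskerRight)
  -- This compatibility already holds over `M`; it is restricted so that both hold over `N` with the
  -- same comparisons.
  have compat_α := restrict_compat n _ _ (congrArg (n ◁ ·) hα')
  have compat_β := whiskerRight_compat g.f _ _ (restrict_compat n _ _ e)
  rw [← mu_hom, ← mu_hom] at compat_α
  rw [← gLam_eq, ← gLam_eq] at compat_β
  refine ⟨N, n ≫ m ≫ t, n ≫ m ≫ t', _, _, ?_, compat_α, compat_β⟩
  -- Neither `t` nor `t'` need be in `W`; through `φ₁` and `θ` the composite is isomorphic to one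
  -- that passes through `x` and `z`.
  refine hW.iso_mem _ _ (hW.comp_mem _ _ (hW.comp_mem _ _ hn (hW.comp_mem _ _ hm hx)) hz) ⟨?_⟩
  exact (Iso.refl _ ≪⊗≫ whiskerLeftIso (n ≫ m ≫ t) (whiskerRightIso F.φ₁ f₁.w) ≪⊗≫
    whiskerLeftIso (n ≫ m) (whiskerRightIso θ.symm (r.v₁ ≫ f₁.w)) ≪⊗≫ Iso.refl _ :
    ((n ≫ m ≫ t) ≫ F.η₃.leg ≫ F.η₁.top) ≫ (c f₁.f g.w g.w_mem).leg ≫ f₁.w ≅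
      (n ≫ m ≫ x) ≫ (z ≫ r.v₁) ≫ f₁.w)

end BicategoryOfFractions

end

open BicategoryOfFractions
theorem mainTheorem6 {C : Type u} [Bicategory.{w, v} C] (W : MorphismProperty C)
    (hW : AdmitsBicalculus W) (c : ChoicesC W) {A B X : C} (g : Mor W B X) (f₁ f₂ : Mor W A B)
    (Γ : TwoMor hW f₁ f₂) :
    (∀ (d : ChoicesD W) (r : TwoMorData f₁ f₂), r.toTwoMor hW = Γ → ∀ F : WhiskerData c r g,
      (F.diagram hW).toTwoMor hW = Γ.whisker c d g) ∧
    (∀ r r' : TwoMorData f₁ f₂, r.toTwoMor hW = Γ → r'.toTwoMor hW = Γ →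
      ∀ (F : WhiskerData c r g) (F' : WhiskerData c r' g),
        (F.diagram hW).Equivalent (F'.diagram hW)) ∧
    (∀ d d' : ChoicesD W, Γ.whisker c d g = Γ.whisker c d' g) := by
  have key : ∀ r r' : TwoMorData f₁ f₂, r.toTwoMor hW = Γ → r'.toTwoMor hW = Γ →
      ∀ (F : WhiskerData c r g) (F' : WhiskerData c r' g),
        (F.diagram hW).Equivalent (F'.diagram hW) := fun r r' h h' F F' =>
    WhiskerData.diagram_equivalent hW (Quotient.exact (s := repSetoid hW f₁ f₂) (h.trans h'.symm))
      F F'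
  -- The data produced by `C(W)` and `D(W)` are one instance of (F8)–(F10), for the representative
  -- `Quotient.out Γ`, so `key` gives all three claims.
  exact ⟨fun d r h F => Quotient.sound (key _ _ h (Quotient.out_eq Γ) _ _), key,
    fun d d' => Quotient.sound (key _ _ (Quotient.out_eq Γ) (Quotient.out_eq Γ) _ _)⟩
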